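/- Call a compact set $\mathcal C\subset\mathbb R^3$ an obstacle if $\mathbb R^3\setminus\mathcal C$ is simply connected; it is a smooth obstacle if moreover its boundary is smooth, i.e. near every boundary point $\mathcal C$ is a sublevel set $\{\rho\le 0\}$ of a $C^\infty$ function $\rho$ with $\nabla\rho\neq0$ at that point. For an open set $\Omega\subset\mathbb R^3$ let $V(\Omega)$ be the space of divergence free vector fields in $C_c^\infty(\Omega;\mathbb R^3)$, let $\mathcal H(\Omega)$ be the closure of $V(\Omega)$ in $L^2(\Omega;\mathbb R^3)$, and let $\mathbb P_\Omega:L^2(\Omega;\mathbb R^3)\to\mathcal H(\Omega)$ be the Leray projection, i.e. the orthogonal projection onto $\mathcal H(\Omega)$. Let $\mathcal C$ be an obstacle (no regularity is assumed), and let $(\mathcal C_n)_{n\in\mathbb N}$ be a sequence of smooth obstacles with $\mathcal C\subset\mathcal C_n$ for all $n$ that converges to $\mathcal C$ in the Hausdorff distance. Put $\Omega=\mathbb R^3\setminus\mathcal C$ and $\Omega_n=\mathbb R^3\setminus\mathcal C_n$. Let $\omega_0\in V(\mathbb R^3)$ and let $$v_0(x)=-\int_{\mathbb R^3}\frac{x-y}{4\pi|x-y|^3}\times\omega_0(y)\,dy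 .$$ Then $v_0\in L^2(\mathbb R^3)$ and $$E\bigl(\mathbb P_{\Omega_n}(v_0|_{\Omega_n})\bigr)\longrightarrow \mathbb P_\Omega(v_0|_\Omega)\quad\text{strongly in } L^2(\Omega),$$ where $E f$ denotes the extension by zero to $\mathbb R^3$ of a field $f$ on $\Omega_n$. -/

import Mathlib

open MeasureTheory Filter Topology
open scoped ContDiff

/-- Three-dimensional Euclidean space. -/
abbrev E3 : Type := EuclideanSpace ℝ (Fin 3)

/-- An obstacle: a compact subset of `ℝ³` whose complement is simply connected. -/
structure IsObstacle (C : Set E3) : Prop where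
  isCompact : IsCompact C
  isSimplyConnected_compl : IsSimplyConnected Cᶜ

/-- A closed set with smooth boundary: near each boundary point it is the sublevel set
`{ρ ≤ 0}` of a smooth function `ρ` with nonvanishing differential there. -/
def HasSmoothBoundary (C : Set E3) : Prop :=
  ∀ x ∈ frontier C, ∃ U : Set E3, IsOpen U ∧ x ∈ U ∧ ∃ ρ : E3 → ℝ,
    ContDiffOn ℝ ∞ ρ U ∧ fderiv ℝ ρ x ≠ 0 ∧ ∀ y ∈ U, y ∈ C ↔ ρ y ≤ 0

/-- A smooth obstacle. -/
structure IsSmoothObstacle (C : Set E3) : Prop extends IsObstacle C where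
  smooth : HasSmoothBoundary C

/-- The divergence `∂₁φ₁ + ∂₂φ₂ + ∂₃φ₃` of a differentiable vector field. -/
noncomputable def divergence (φ : E3 → E3) (x : E3) : ℝ :=
  ∑ i : Fin 3, fderiv ℝ φ x (EuclideanSpace.single i 1) i

/-- `V(Ω)`: smooth divergence free vector fields with compact support in `Ω`. -/
def solenoidalTest (Ω : Set E3) : Submodule ℝ (E3 → E3) where
  carrier := {φ | ContDiff ℝ ∞ φ ∧ HasCompactSupport φ ∧ tsupport φ ⊆ Ω ∧
    ∀ x ∈ Ω, divergence φ x = 0}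
  zero_mem' := by
    refine ⟨contDiff_const, HasCompactSupport.zero, by simp [tsupport], fun x _ => ?_⟩
    simp [divergence]
  add_mem' := by
    rintro φ ψ ⟨h1, h2, h3, h4⟩ ⟨k1, k2, k3, k4⟩
    refine ⟨h1.add k1, h2.add k2, (tsupport_add φ ψ).trans (Set.union_subset h3 k3),
      fun x hx => ?_⟩
    have hφ : DifferentiableAt ℝ φ x := h1.differentiable (by simp) x
    have hψ : DifferentiableAt ℝ ψ x := k1.differentiable (by simp) x
    have e : divergence (φ + ψ) x = divergence φ x + divergence ψ x := by
      simp [divergence, fderiv_add hφ hψ, Finset.sum_add_distrib]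
    rw [e, h4 x hx, k4 x hx, add_zero]
  smul_mem' := by
    rintro c φ ⟨h1, h2, h3, h4⟩
    refine ⟨contDiff_const.smul h1, h2.smul_left (f := fun _ => c),
      (closure_mono (Function.support_const_smul_subset c φ)).trans h3, fun x hx => ?_⟩
    have hφ : DifferentiableAt ℝ φ x := h1.differentiable (by simp) x
    have e : divergence (c • φ) x = c * divergence φ x := by
      simp [divergence, fderiv_const_smul hφ, Finset.mul_sum]
    rw [e, h4 x hx, mul_zero]

/-- `L²(Ω)`: square integrable vector fields on `Ω`. -/
abbrev L2Field (Ω : Set E3) : Type := Lp E3 2 ((volume : Measure E3).restrict Ω)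

/-- The classes in `L²(Ω)` of the fields in `V(Ω)`. -/
def solenoidalTestL2 (Ω : Set E3) : Submodule ℝ (L2Field Ω) where
  carrier := {f | ∃ φ ∈ solenoidalTest Ω, f =ᵐ[(volume : Measure E3).restrict Ω] φ}
  zero_mem' := ⟨0, Submodule.zero_mem _, Lp.coeFn_zero _ _ _⟩
  add_mem' := by
    rintro f g ⟨φ, hφ, hf⟩ ⟨ψ, hψ, hg⟩
    exact ⟨φ + ψ, Submodule.add_mem _ hφ hψ, (Lp.coeFn_add f g).trans (hf.add hg)⟩
  smul_mem' := by
    rintro c f ⟨φ, hφ, hf⟩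
    exact ⟨c • φ, Submodule.smul_mem _ c hφ, (Lp.coeFn_smul c f).trans (hf.const_smul c)⟩

/-- `𝓗(Ω)`: the closure of `V(Ω)` in `L²(Ω)`. -/
noncomputable def solenoidalSpace (Ω : Set E3) : Submodule ℝ (L2Field Ω) :=
  (solenoidalTestL2 Ω).topologicalClosure

noncomputable instance (Ω : Set E3) : (solenoidalSpace Ω).HasOrthogonalProjection :=
  inferInstanceAs (solenoidalTestL2 Ω).topologicalClosure.HasOrthogonalProjection

/-- The Leray projection `ℙ_Ω`: the orthogonal projection of `L²(Ω)` onto `𝓗(Ω)`. -/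
noncomputable def lerayProjection (Ω : Set E3) : L2Field Ω →L[ℝ] solenoidalSpace Ω :=
  (solenoidalSpace Ω).orthogonalProjectionOnto

/-- The vector product in `ℝ³`. -/
def cross (a b : E3) : E3 := WithLp.toLp 2 (crossProduct a.ofLp b.ofLp)

/-- The Biot-Savart field `x ↦ -∫ (x - y) / (4π |x - y|³) × w(y) dy`. -/
noncomputable def biotSavart (w : E3 → E3) (x : E3) : E3 :=
  -∫ y : E3, cross ((1 / (4 * Real.pi * ‖x - y‖ ^ 3)) • (x - y)) (w y)

/-- The restriction to `Ω` of a square integrable field on `ℝ³`, as an element of `L²(Ω)`. -/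
noncomputable def restrictL2 (Ω : Set E3) {v : E3 → E3} (hv : MemLp v 2 volume) : L2Field Ω :=
  (hv.restrict Ω).toLp v

/-- The extension by zero to `ℝ³` of a field on `Ω`. -/
noncomputable def extendZero (Ω : Set E3) (f : L2Field Ω) : E3 → E3 :=
  Ω.indicator f

/-! ### Square integrability of the Biot-Savart field -/

/-! Extension by zero embeds `L²(Ωₙ)` isometrically in `L²(Ω)`, maps `𝓗(Ωₙ)` into `𝓗(Ω)`, and is
adjoint to restriction. Hence the extended projection of `v₀` on `Ωₙ` is the best approximation of
`v₀`, and so of `ℙ_Ω v₀`, within the extended copy of `𝓗(Ωₙ)`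
(`norm_extendL2_lerayProjection_sub_le`). Now `ℙ_Ω v₀` is an `L²` limit of test fields, and the
compact support of each one lies at positive distance from `C`, hence in `Ωₙ` for large `n`. Each
test field is then an admissible competitor, so the error tends to zero. That `v₀` is in `L²`
follows from its bound by a multiple of `(1 + |x|)⁻²`, which is square integrable in dimension
three. -/

theorem norm_cross_le (a b : E3) : ‖cross a b‖ ≤ ‖a‖ * ‖b‖ := by
  rw [cross, InnerProductGeometry.norm_ofLp_crossProduct]
  exact mul_le_of_le_one_right (by positivity) (Real.sin_le_one _)

theorem continuous_cross : Continuous fun p : E3 × E3 => cross p.1 p.2 := by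
  unfold cross
  refine (PiLp.continuous_toLp 2 _).comp (continuous_pi fun i => ?_)
  fin_cases i <;> simp [cross_apply] <;> fun_prop

theorem norm_biotSavart_kernel_le (z w : E3) :
    ‖cross ((1 / (4 * Real.pi * ‖z‖ ^ 3)) • z) w‖ ≤ (‖z‖ ^ 2)⁻¹ * ‖w‖ := by
  refine (norm_cross_le _ _).trans (mul_le_mul_of_nonneg_right ?_ (norm_nonneg w))
  rcases eq_or_ne z 0 with rfl | hz
  · simp
  have hz' : 0 < ‖z‖ := norm_pos_iff.2 hz
  have hpi : (1 : ℝ) ≤ 4 * Real.pi := by linarith [Real.pi_gt_three]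
  rw [norm_smul, Real.norm_of_nonneg (by positivity)]
  have e : 1 / (4 * Real.pi * ‖z‖ ^ 3) * ‖z‖ = (4 * Real.pi)⁻¹ * (‖z‖ ^ 2)⁻¹ := by
    field_simp
  rw [e]
  exact mul_le_of_le_one_left (by positivity) (inv_le_one_of_one_le₀ hpi)

theorem measurable_biotSavart {w : E3 → E3} (hw : Measurable w) : Measurable (biotSavart w) := by
  have hm : Measurable fun p : E3 × E3 =>
      cross ((1 / (4 * Real.pi * ‖p.1 - p.2‖ ^ 3)) • (p.1 - p.2)) (w p.2) := by
    have h1 : Measurable fun p : E3 × E3 =>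
        (1 / (4 * Real.pi * ‖p.1 - p.2‖ ^ 3)) • (p.1 - p.2) := by fun_prop
    exact continuous_cross.measurable.comp (h1.prodMk (hw.comp measurable_snd))
  exact (hm.stronglyMeasurable.integral_prod_right' (ν := volume)).measurable.neg

/-- The singularity has order 2, below the dimension 3. -/
theorem integrable_indicator_ball_inv_norm_sq :
    Integrable ((Metric.ball (0 : E3) 1).indicator fun z => (‖z‖ ^ 2)⁻¹) := by
  rw [integrable_indicator_iff Metric.isOpen_ball.measurableSet]
  refine integrableOn_ball_of_norm_le_rpow (C := 1) (α := 2) (by simp) (by simp; norm_num)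
    (ae_of_all _ fun x => ?_) (Measurable.aestronglyMeasurable (by fun_prop))
  rw [Real.norm_of_nonneg (by positivity), one_mul, Real.rpow_neg (norm_nonneg x)]
  exact_mod_cast le_rfl

/-- The Biot-Savart field of a bounded, compactly supported field decays quadratically. -/
theorem exists_norm_biotSavart_le {w : E3 → E3} (hc : Continuous w) (hs : HasCompactSupport w) :
    ∃ A : ℝ, ∀ x, ‖biotSavart w x‖ ≤ A * ((1 + ‖x‖) ^ 2)⁻¹ := by
  obtain ⟨M, hM⟩ := hs.exists_bound_of_continuous hc
  obtain ⟨R, hR0, hR⟩ := hs.isCompact.isBounded.exists_pos_norm_le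
  set k : E3 → ℝ := (Metric.ball (0 : E3) 1).indicator fun z => (‖z‖ ^ 2)⁻¹ with hk
  -- From `(a + b)² ≤ 2a² + 2b²` with `a = 1 + R`, `b = ‖x - y‖`, where `R` bounds the support of
  -- `w`.
  set B : ℝ := 2 * (1 + R) ^ 2 with hB
  have hB0 : 0 ≤ B := by positivity
  have hki : Integrable k := integrable_indicator_ball_inv_norm_sq
  have hwi : Integrable fun y => ‖w y‖ := (hc.integrable_of_hasCompactSupport hs).norm
  have hk0 : ∀ z, 0 ≤ k z := fun z => Set.indicator_nonneg (fun _ _ => by positivity) z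
  have hkle : ∀ z, (‖z‖ ^ 2)⁻¹ ≤ k z + 1 := by
    intro z
    by_cases hz : z ∈ Metric.ball (0 : E3) 1
    · rw [hk, Set.indicator_of_mem hz]
      linarith
    · have h1 : 1 ≤ ‖z‖ := by simpa using hz
      linarith [hk0 z, inv_le_one_of_one_le₀ (one_le_pow₀ h1 (n := 2))]
  have hsq : ∀ z : E3, ‖z‖ ^ 2 * (‖z‖ ^ 2)⁻¹ ≤ 1 := fun z => mul_inv_le_one
  -- The weight is traded for `B + 2‖x - y‖²`: the second term cancels the kernel, the first leaves
  -- its integrable singularity. The integral of the right side over `y` does not depend on `x`.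
  have key : ∀ x y, (1 + ‖x‖) ^ 2 * ((‖x - y‖ ^ 2)⁻¹ * ‖w y‖)
      ≤ B * M * k (x - y) + (B + 2) * ‖w y‖ := by
    intro x y
    have hM0 : 0 ≤ M := (norm_nonneg _).trans (hM y)
    by_cases hy : w y = 0
    · simp only [hy, norm_zero, mul_zero, add_zero]
      exact mul_nonneg (mul_nonneg hB0 hM0) (hk0 _)
    have hyR : ‖y‖ ≤ R := hR y (subset_tsupport _ hy)
    have htri : ‖x‖ ≤ ‖x - y‖ + ‖y‖ := by simpa using norm_add_le (x - y) y
    have h1 : (1 + ‖x‖) ^ 2 ≤ B + 2 * ‖x - y‖ ^ 2 := by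
      have : (1 + ‖x‖) ^ 2 ≤ ((1 + R) + ‖x - y‖) ^ 2 :=
        pow_le_pow_left₀ (by positivity) (by linarith) 2
      nlinarith [sq_nonneg ((1 + R) - ‖x - y‖)]
    have hkw : k (x - y) * ‖w y‖ ≤ k (x - y) * M := mul_le_mul_of_nonneg_left (hM y) (hk0 _)
    calc (1 + ‖x‖) ^ 2 * ((‖x - y‖ ^ 2)⁻¹ * ‖w y‖)
        ≤ (B + 2 * ‖x - y‖ ^ 2) * ((‖x - y‖ ^ 2)⁻¹ * ‖w y‖) :=
          mul_le_mul_of_nonneg_right h1 (by positivity)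
      _ = B * ((‖x - y‖ ^ 2)⁻¹ * ‖w y‖) + 2 * ((‖x - y‖ ^ 2 * (‖x - y‖ ^ 2)⁻¹) * ‖w y‖) := by
          ring
      _ ≤ B * ((k (x - y) + 1) * ‖w y‖) + 2 * (1 * ‖w y‖) := by
          gcongr
          · exact hkle _
          · exact hsq _
      _ = B * (k (x - y) * ‖w y‖) + (B + 2) * ‖w y‖ := by ring
      _ ≤ B * (k (x - y) * M) + (B + 2) * ‖w y‖ := by gcongr
      _ = B * M * k (x - y) + (B + 2) * ‖w y‖ := by ring
  refine ⟨B * M * (∫ z, k z) + (B + 2) * ∫ y, ‖w y‖, fun x => ?_⟩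
  have hx : 0 < (1 + ‖x‖) ^ 2 := by positivity
  have hi1 : Integrable fun y => B * M * k (x - y) := (hki.comp_sub_left x).const_mul _
  have hi2 : Integrable fun y => (B + 2) * ‖w y‖ := hwi.const_mul _
  have hint : ∫ y, (B * M * k (x - y) + (B + 2) * ‖w y‖) * ((1 + ‖x‖) ^ 2)⁻¹
      = (B * M * (∫ z, k z) + (B + 2) * ∫ y, ‖w y‖) * ((1 + ‖x‖) ^ 2)⁻¹ := by
    rw [integral_mul_const, integral_add hi1 hi2, integral_const_mul, integral_const_mul,
      integral_sub_left_eq_self k volume x]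
  rw [← hint, biotSavart, norm_neg]
  refine norm_integral_le_of_norm_le ((hi1.add hi2).mul_const _) (ae_of_all _ fun y => ?_)
  refine (norm_biotSavart_kernel_le (x - y) (w y)).trans ?_
  rw [← div_eq_mul_inv, le_div_iff₀ hx, mul_comm]
  exact key x y

theorem memLp_biotSavart {w : E3 → E3} (hc : Continuous w) (hs : HasCompactSupport w) :
    MemLp (biotSavart w) 2 volume := by
  obtain ⟨A, hA⟩ := exists_norm_biotSavart_le hc hs
  have hg : MemLp (fun x : E3 => A * ((1 + ‖x‖) ^ 2)⁻¹) 2 volume := by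
    refine MemLp.const_mul ?_ A
    rw [memLp_two_iff_integrable_sq (Measurable.aestronglyMeasurable (by fun_prop))]
    -- The squared bound decays with exponent 4, above the dimension 3.
    refine (integrable_one_add_norm (E := E3) (μ := volume) (r := 4) (by simp; norm_num)).congr
      (ae_of_all _ fun x => ?_)
    have h0 : (0 : ℝ) ≤ 1 + ‖x‖ := by positivity
    simp only
    rw [Real.rpow_neg h0, inv_pow, ← pow_mul]
    norm_cast
  refine hg.mono (measurable_biotSavart hc.measurable).aestronglyMeasurable
    (ae_of_all _ fun x => ?_)
  exact (hA x).trans (le_abs_self _)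

/-! ### Extension by zero -/

theorem volume_restrict_restrict_of_subset {U Ω : Set E3} (hU : MeasurableSet U) (h : U ⊆ Ω) :
    ((volume : Measure E3).restrict Ω).restrict U = volume.restrict U := by
  rw [Measure.restrict_restrict hU, Set.inter_eq_left.2 h]

theorem memLp_extendZero {U Ω : Set E3} (hU : MeasurableSet U) (h : U ⊆ Ω) (f : L2Field U) :
    MemLp (extendZero U f) 2 ((volume : Measure E3).restrict Ω) := by
  rw [extendZero, memLp_indicator_iff_restrict hU, volume_restrict_restrict_of_subset hU h]
  exact Lp.memLp f

theorem indicator_ae_eq_of_restrict {U Ω : Set E3} (hU : MeasurableSet U) {f g : E3 → E3}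
    (hfg : f =ᵐ[(volume : Measure E3).restrict U] g) :
    U.indicator f =ᵐ[(volume : Measure E3).restrict Ω] U.indicator g := by
  rw [EventuallyEq, ae_restrict_iff' hU] at hfg
  refine ae_restrict_of_ae ?_
  filter_upwards [hfg] with x hx
  by_cases hxU : x ∈ U
  · simp [hxU, hx hxU]
  · simp [hxU]

/-- Extension by zero as a linear isometry from `L²(U)` to `L²(Ω)`, for `U ⊆ Ω`. -/
noncomputable def extendL2 {U Ω : Set E3} (hU : MeasurableSet U) (h : U ⊆ Ω) :
    L2Field U →ₗᵢ[ℝ] L2Field Ω where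
  toFun f := (memLp_extendZero hU h f).toLp _
  map_add' f g := by
    rw [← MemLp.toLp_add]
    refine MemLp.toLp_congr _ _ ?_
    refine (indicator_ae_eq_of_restrict hU (Lp.coeFn_add f g)).trans (Eventually.of_forall ?_)
    intro x
    by_cases hx : x ∈ U <;> simp [extendZero, hx]
  map_smul' c f := by
    rw [RingHom.id_apply, ← MemLp.toLp_const_smul]
    refine MemLp.toLp_congr _ _ ?_
    refine (indicator_ae_eq_of_restrict hU (Lp.coeFn_smul c f)).trans (Eventually.of_forall ?_)
    intro x
    by_cases hx : x ∈ U <;> simp [extendZero, hx]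
  norm_map' f := by
    change ‖(memLp_extendZero hU h f).toLp _‖ = _
    rw [Lp.norm_toLp, extendZero, eLpNorm_indicator_eq_eLpNorm_restrict hU,
      volume_restrict_restrict_of_subset hU h, Lp.norm_def]

theorem coeFn_extendL2 {U Ω : Set E3} (hU : MeasurableSet U) (h : U ⊆ Ω) (f : L2Field U) :
    extendL2 hU h f =ᵐ[(volume : Measure E3).restrict Ω] extendZero U f :=
  MemLp.coeFn_toLp (memLp_extendZero hU h f)

/-- Extension by zero is adjoint to restriction: both pairings are the integral of `f · v` over `U`.
-/
theorem inner_extendL2_restrictL2 {U Ω : Set E3} (hU : MeasurableSet U) (h : U ⊆ Ω)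
    {v : E3 → E3} (hv : MemLp v 2 volume) (f : L2Field U) :
    inner ℝ (extendL2 hU h f) (restrictL2 Ω hv) = inner ℝ f (restrictL2 U hv) := by
  rw [L2.inner_def, L2.inner_def]
  have h1 : (fun x => inner ℝ (extendL2 hU h f x) (restrictL2 Ω hv x))
      =ᵐ[(volume : Measure E3).restrict Ω] U.indicator fun x => inner ℝ (f x) (v x) := by
    filter_upwards [coeFn_extendL2 hU h f, MemLp.coeFn_toLp (hv.restrict Ω)] with x hx hx'
    rw [hx, restrictL2, hx', extendZero]
    by_cases hxU : x ∈ U <;> simp [hxU]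
  have h2 : (fun x => inner ℝ (f x) (restrictL2 U hv x))
      =ᵐ[(volume : Measure E3).restrict U] fun x => inner ℝ (f x) (v x) := by
    filter_upwards [MemLp.coeFn_toLp (hv.restrict U)] with x hx
    rw [restrictL2, hx]
  rw [integral_congr_ae h1, integral_congr_ae h2, integral_indicator hU,
    volume_restrict_restrict_of_subset hU h]

/-! ### Solenoidal fields on nested domains -/

theorem divergence_eq_zero_of_notMem_tsupport {φ : E3 → E3} {x : E3} (hx : x ∉ tsupport φ) :
    divergence φ x = 0 := by
  have h0 : fderiv ℝ φ x = 0 := by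
    by_contra hne
    exact hx (tsupport_fderiv_subset ℝ (subset_tsupport _ hne))
  simp [divergence, h0]

theorem solenoidalTest_mono {U Ω : Set E3} (h : U ⊆ Ω) : solenoidalTest U ≤ solenoidalTest Ω := by
  rintro φ ⟨h1, h2, h3, h4⟩
  refine ⟨h1, h2, h3.trans h, fun x _ => ?_⟩
  by_cases hx : x ∈ U
  · exact h4 x hx
  · exact divergence_eq_zero_of_notMem_tsupport fun hx' => hx (h3 hx')

theorem extendZero_ae_eq_of_support_subset {U Ω : Set E3} (hU : MeasurableSet U)
    {f : L2Field U} {φ : E3 → E3} (hf : f =ᵐ[(volume : Measure E3).restrict U] φ)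
    (hφ : Function.support φ ⊆ U) :
    extendZero U f =ᵐ[(volume : Measure E3).restrict Ω] φ := by
  have := indicator_ae_eq_of_restrict (Ω := Ω) hU hf
  rwa [Set.indicator_eq_self.2 hφ] at this

theorem extendL2_mem_solenoidalSpace {U Ω : Set E3} (hU : MeasurableSet U) (h : U ⊆ Ω)
    {f : L2Field U} (hf : f ∈ solenoidalSpace U) : extendL2 hU h f ∈ solenoidalSpace Ω := by
  refine map_mem_closure (extendL2 hU h).continuous hf ?_
  rintro g ⟨φ, hφ, hg⟩
  exact ⟨φ, solenoidalTest_mono h hφ, (coeFn_extendL2 hU h g).trans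
    (extendZero_ae_eq_of_support_subset hU hg ((subset_tsupport φ).trans hφ.2.2.1))⟩

/-- Supplies the competitors: a test field on `Ω` supported in `U` is already a test field on `U`.
-/
theorem exists_extendL2_eq {U Ω : Set E3} (hU : MeasurableSet U) (h : U ⊆ Ω)
    {g : L2Field Ω} {φ : E3 → E3} (hφ : φ ∈ solenoidalTest Ω)
    (hg : g =ᵐ[(volume : Measure E3).restrict Ω] φ) (hφU : tsupport φ ⊆ U) :
    ∃ f ∈ solenoidalSpace U, extendL2 hU h f = g := by
  have hmem : MemLp φ 2 ((volume : Measure E3).restrict U) :=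
    hφ.1.continuous.memLp_of_hasCompactSupport hφ.2.1
  refine ⟨hmem.toLp φ, subset_closure
    ⟨φ, ⟨hφ.1, hφ.2.1, hφU, fun x hx => hφ.2.2.2 x (h hx)⟩, hmem.coeFn_toLp⟩, Lp.ext ?_⟩
  exact ((coeFn_extendL2 hU h _).trans (extendZero_ae_eq_of_support_subset hU hmem.coeFn_toLp
    ((subset_tsupport φ).trans hφU))).trans hg.symm

/-- The extended Leray projection on a smaller domain is at least as close to the Leray projection
on the larger domain as any extension of a field in `𝓗(U)`. -/
theorem norm_extendL2_lerayProjection_sub_le {U Ω : Set E3} (hU : MeasurableSet U) (h : U ⊆ Ω)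
    {v : E3 → E3} (hv : MemLp v 2 volume) {f : L2Field U} (hf : f ∈ solenoidalSpace U) :
    ‖extendL2 hU h (lerayProjection U (restrictL2 U hv)) - lerayProjection Ω (restrictL2 Ω hv)‖
      ≤ ‖extendL2 hU h f - lerayProjection Ω (restrictL2 Ω hv)‖ := by
  set p : L2Field U := ↑(lerayProjection U (restrictL2 U hv)) with hp
  set q : L2Field Ω := ↑(lerayProjection Ω (restrictL2 Ω hv)) with hq
  have hpU : p ∈ solenoidalSpace U := (lerayProjection U (restrictL2 U hv)).2
  have hd : f - p ∈ solenoidalSpace U := sub_mem hf hpU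
  have e1 : inner ℝ (restrictL2 U hv - p) (f - p) = 0 :=
    Submodule.starProjection_inner_eq_zero _ _ hd
  have e2 : inner ℝ (restrictL2 Ω hv - q) (extendL2 hU h (f - p)) = 0 :=
    Submodule.starProjection_inner_eq_zero _ _ (extendL2_mem_solenoidalSpace hU h hd)
  -- By adjointness, `v` pairs equally with `f - p` on `U` and with its extension on `Ω`. The two
  -- projection identities therefore give equal pairings with `p` and `q`, and Pythagoras applies.
  have e3 : inner ℝ (extendL2 hU h (f - p)) (extendL2 hU h p - q) = 0 := by
    rw [real_inner_comm, inner_sub_right] at e1 e2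
    rw [inner_sub_right, LinearIsometry.inner_map_map]
    linarith [inner_extendL2_restrictL2 hU h hv (f - p)]
  have e4 : extendL2 hU h f - q = extendL2 hU h (f - p) + (extendL2 hU h p - q) := by
    rw [map_sub]; abel
  have e5 := norm_add_sq_eq_norm_sq_add_norm_sq_real e3
  rw [← e4] at e5
  nlinarith [norm_nonneg (extendL2 hU h f - q), norm_nonneg (extendL2 hU h p - q),
    mul_self_nonneg ‖extendL2 hU h (f - p)‖]

/-- A compact set disjoint from a closed set `C` is eventually disjoint from sets converging to `C`
in the Hausdorff distance. -/
theorem eventually_subset_compl_of_hausdorffEDist {X : Type*} [PseudoEMetricSpace X] {C K : Set X}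
    (hC : IsClosed C) (hK : IsCompact K) (hKC : K ⊆ Cᶜ) {Cn : ℕ → Set X}
    (hconv : Tendsto (fun n => Metric.hausdorffEDist (Cn n) C) atTop (𝓝 0)) :
    ∀ᶠ n in atTop, K ⊆ (Cn n)ᶜ := by
  -- `r` separates `K` from `C`; a point of `K` in `Cn n` would force Hausdorff distance at least
  -- `r`.
  obtain ⟨r, hr, hlt⟩ := Metric.exists_pos_forall_lt_edist hK hC
    (Set.subset_compl_iff_disjoint_right.1 hKC)
  filter_upwards [hconv.eventually_lt_const (ENNReal.coe_pos.2 hr)] with n hn x hxK hxn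
  refine (hn.trans_le ?_).not_ge (Metric.infEDist_le_hausdorffEDist_of_mem hxn)
  exact Metric.le_infEDist.2 fun y hy => (hlt x hxK y hy).le

/-- Stability of the Leray projection under exhaustion: if every compact subset of `Ω` is eventually
contained in the subdomains `U n`, then the extended projections converge in `L²(Ω)`. -/
theorem tendsto_extendL2_lerayProjection {Ω : Set E3} {U : ℕ → Set E3}
    (hU : ∀ n, MeasurableSet (U n)) (h : ∀ n, U n ⊆ Ω)
    (hex : ∀ K ⊆ Ω, IsCompact K → ∀ᶠ n in atTop, K ⊆ U n)
    {v : E3 → E3} (hv : MemLp v 2 volume) :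
    Tendsto (fun n => extendL2 (hU n) (h n) (lerayProjection (U n) (restrictL2 (U n) hv)))
      atTop (𝓝 (lerayProjection Ω (restrictL2 Ω hv) : L2Field Ω)) := by
  rw [Metric.tendsto_nhds]
  intro ε hε
  obtain ⟨g, ⟨φ, hφ, hg⟩, hgε⟩ := Metric.mem_closure_iff.1
    (lerayProjection Ω (restrictL2 Ω hv)).2 ε hε
  filter_upwards [hex _ hφ.2.2.1 hφ.2.1.isCompact] with n hn
  obtain ⟨f, hf, rfl⟩ := exists_extendL2_eq (hU n) (h n) hφ hg hn
  rw [dist_eq_norm]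
  refine (norm_extendL2_lerayProjection_sub_le (hU n) (h n) hv hf).trans_lt ?_
  rwa [← dist_eq_norm, dist_comm]

theorem mainTheorem4 (C : Set E3) (hC : IsObstacle C)
    (Cn : ℕ → Set E3) (hCn : ∀ n, IsSmoothObstacle (Cn n))
    (hsub : ∀ n, C ⊆ Cn n)
    (hconv : Tendsto (fun n => Metric.hausdorffEDist (Cn n) C) atTop (𝓝 0))
    (ω₀ : E3 → E3) (hω₀ : ω₀ ∈ solenoidalTest Set.univ) :
    ∃ hv : MemLp (biotSavart ω₀) 2 volume,
      Tendsto
        (fun n => eLpNorm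
          (extendZero (Cn n)ᶜ (lerayProjection (Cn n)ᶜ (restrictL2 (Cn n)ᶜ hv) : L2Field (Cn n)ᶜ)
            - ⇑(lerayProjection Cᶜ (restrictL2 Cᶜ hv) : L2Field Cᶜ))
          2 (volume.restrict Cᶜ))
        atTop (𝓝 0) := by
  have hv := memLp_biotSavart hω₀.1.continuous hω₀.2.1
  refine ⟨hv, ?_⟩
  have hU : ∀ n, MeasurableSet (Cn n)ᶜ := fun n => (hCn n).isCompact.measurableSet.compl
  have hs : ∀ n, (Cn n)ᶜ ⊆ Cᶜ := fun n => Set.compl_subset_compl.2 (hsub n)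
  have key := tendsto_extendL2_lerayProjection hU hs (fun K hKC hK =>
    eventually_subset_compl_of_hausdorffEDist hC.isCompact.isClosed hK hKC hconv) hv
  rw [Lp.tendsto_Lp_iff_tendsto_eLpNorm'] at key
  refine key.congr fun n => eLpNorm_congr_ae ?_
  exact (coeFn_extendL2 (hU n) (hs n) _).sub EventuallyEq.rfl
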